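/- Let $\mathbf X=(X_n)_{n\ge 1}$ be a stationary real-valued stochastic process with values in $\mathcal X\subseteq\mathbb R$ and let $g:\mathcal X\to\mathcal Y\subseteq\mathbb R$ be a piecewise bijective function, i.e. $g$ is measurable and surjective, there is an at most countable partition $\{\mathcal X_i\}$ of $\mathcal X$ into measurable sets such that each restriction $g_i=g|_{\mathcal X_i}$ is a bijection onto its image and is differentiable at every point of $\mathcal X_i$ (as a function on $\mathcal X_i$), and the resulting derivative, defined by $g'(x)=g_i'(x)$ for $x\in\mathcal X_i$, satisfies $g'(X_1)\neq 0$ almost surely. Put $Y_n=g(X_n)$. Assume that for every $n$ the blocks $X_1^n=(X_1,\dots,X_n)$ and $Y_1^n=(Y_1,\dots,Y_n)$ have joint probability densities and finite differential entropies $h(X_1^n)$, $h(Y_1^n)$, where $h(Z)=-\int f_Z\log_2 f_Z$, and that the differential entropy rates $\bar h(\mathbf X)=\lim_n\frac1n h(X_1^n)$ and $\bar h(\mathbf Y)=\lim_n\frac1n h(Y_1^n)$ exist and are finite. Let $H(X_1^n|Y_1^n)=\int H(X_1^n|Y_1^n=y)\,dP_{Y_1^n}(y)\in[0,\infty]$,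 where $H(X_1^n|Y_1^n=y)$ is the Shannon entropy in bits of the conditional distribution of $X_1^n$ given $Y_1^n=y$ (and $\infty$ if that distribution is not discrete). Then the expectation $E[\log_2|g'(X_1)|]$ exists in $(-\infty,\infty]$, the limit $\lim_{n\to\infty}\frac1n H(X_1^n|Y_1^n)$ (the information loss rate) exists in $[0,\infty]$, and $$\lim_{n\to\infty}\frac1n H(X_1^n|Y_1^n)=\bar h(\mathbf X)-\bar h(\mathbf Y)+E[\log_2|g'(X_1)|],$$ where both sides may be $+\infty$. -/

import Mathlib

open MeasureTheory ProbabilityTheory Filter Topology Set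
open scoped ENNReal

namespace LossRate

/-- The block `(X_1, …, X_n)` of the first `n` samples of a process; the sample `X_{i+1}` of the
usual numbering is `X i`. -/
def block {Ω : Type*} (X : ℕ → Ω → ℝ) (n : ℕ) (ω : Ω) : Fin n → ℝ := fun i => X i ω

/-- (Strict) stationarity: every time shift of the process has the same law as the process, as a
random sequence. -/
def IsStationary {Ω : Type*} [MeasurableSpace Ω] (P : Measure Ω) (X : ℕ → Ω → ℝ) : Prop :=
  ∀ k : ℕ, IdentDistrib (fun ω n => X (n + k) ω) (fun ω n => X n ω) P P

open Classical in
/-- Shannon entropy in bits of a probability measure: `∑ -μ{x} log₂ μ{x}` if `μ` is discrete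
(carried by a countable set), and `∞` otherwise. -/
noncomputable def entropy {α : Type*} [MeasurableSpace α] (μ : Measure α) : ℝ≥0∞ :=
  if ∃ s : Set α, s.Countable ∧ μ sᶜ = 0 then
    ∑' x : α, ENNReal.ofReal (Real.negMulLog (μ.real {x}) / Real.log 2)
  else ∞

/-- Conditional entropy `H(U | V) = ∫ H(U | V = v) dP_V(v)` in bits, where `H(U | V = v)` is the
entropy of the regular conditional distribution of `U` given `V = v`. -/
noncomputable def condEntropy {Ω α β : Type*} [MeasurableSpace Ω] [MeasurableSpace α]
    [StandardBorelSpace α] [Nonempty α] [MeasurableSpace β]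
    (P : Measure Ω) [IsFiniteMeasure P] (U : Ω → α) (V : Ω → β) : ℝ≥0∞ :=
  ∫⁻ v, entropy (condDistrib U V P v) ∂(P.map V)

/-- The probability density of a probability measure on `ℝⁿ` (with respect to Lebesgue measure). -/
noncomputable def density {n : ℕ} (μ : Measure (Fin n → ℝ)) (x : Fin n → ℝ) : ℝ :=
  (μ.rnDeriv volume x).toReal

/-- Differential entropy in bits, `-∫ f log₂ f`, of a probability measure on `ℝⁿ` with
density `f`. -/
noncomputable def diffEntropy {n : ℕ} (μ : Measure (Fin n → ℝ)) : ℝ :=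
  ∫ x, Real.negMulLog (density μ x) / Real.log 2

/-- The differential entropy of `μ` exists and is finite: `μ` has a density `f`, and `f log f` is
integrable. -/
def HasFiniteDiffEntropy {n : ℕ} (μ : Measure (Fin n → ℝ)) : Prop :=
  μ ≪ volume ∧ Integrable (fun x => Real.negMulLog (density μ x)) volume

/-- The differential entropy rate `lim (1/n) h(X_1, …, X_n)` exists and equals the real
number `h`. -/
def HasDiffEntropyRate {Ω : Type*} [MeasurableSpace Ω] (P : Measure Ω) (X : ℕ → Ω → ℝ)
    (h : ℝ) : Prop :=
  Tendsto (fun n : ℕ => diffEntropy (P.map (block X n)) / n) atTop (𝓝 h)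

/-- The derivative of a function given piecewise on the pairwise disjoint sets `S i`: at a point
`x` of `S i` it is the derivative at `x` of the restriction of `g` to `S i` (so one-sided at an end
point of an interval `S i`). -/
noncomputable def pieceDeriv {ι : Type*} (S : ι → Set ℝ) (g : ℝ → ℝ) (x : ℝ) : ℝ :=
  derivWithin g (⋃ i, ⋃ (_ : x ∈ S i), S i) x

/-- `g`, restricted to `D`, is a piecewise bijective function from `D` onto `E` with respect to the
partition `S` of `D` and the input distribution `μ`. (At most countable: `ι` is countable; empty
pieces are harmless. Each `g_i` is a bijection of `S i` onto its image. A function whose pieces are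
differentiable on the closures of the `S i` in particular has a derivative on each `S i`.) -/
structure IsPBF {ι : Type*} [Countable ι] (μ : Measure ℝ) (D E : Set ℝ) (S : ι → Set ℝ)
    (g : ℝ → ℝ) : Prop where
  measurable : Measurable (fun x : D => g x)
  image_eq : g '' D = E
  measurableSet_piece : ∀ i, MeasurableSet (S i)
  disjoint : Pairwise (fun i j => Disjoint (S i) (S j))
  iUnion_eq : ⋃ i, S i = D
  bijOn : ∀ i, BijOn g (S i) (g '' S i)
  differentiable : ∀ i, DifferentiableOn ℝ g (S i)
  deriv_ne_zero : ∀ᵐ x ∂μ, pieceDeriv S g x ≠ 0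

/-- The expectation of a real random variable as an extended real number,
`E[Z⁺] - E[Z⁻]`. Meaningful if `Z` is measurable up to a null set and one of the two is finite. -/
noncomputable def extExpectation {Ω : Type*} [MeasurableSpace Ω] (P : Measure Ω)
    (Z : Ω → ℝ) : EReal :=
  ((∫⁻ ω, ENNReal.ofReal (Z ω) ∂P : ℝ≥0∞) : EReal) -
    ((∫⁻ ω, ENNReal.ofReal (-Z ω) ∂P : ℝ≥0∞) : EReal)

end LossRate

/-!
The conditional law of `U = (X_1, …, X_n)` given `V = (Y_1, …, Y_n)` has a countable carrier: `V` is
the image of `U` under the coordinatewise map `T` of `g`, and `T` is injective on each of the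
countably many boxes `S (k 1) × ⋯ × S (k n)`. For such a law the conditional entropy is the mean of
the surprisal `-log₂ p`, where `p = P(U = u | V = T u)` is evaluated at `u = U`
(`condEntropy_eq_lintegral`).

Computing the probability that `U` lies in a subset of a box by means of the area formula for `T`
identifies this point probability: with `f` and `q` the densities of `U` and `V`, almost surely
`f(U) = |det T'(U)| q(V) p` (`rnDeriv_eq_singleton_mul`). The derivative of `T` is diagonal, so
taking logarithms gives
`-log₂ p = log₂ q(V) - log₂ f(U) + ∑ log₂ |g'(X_i)|`.

The first two terms are integrable, with means `-h(V)` and `h(U)`, and the whole right-hand side is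
nonnegative because `p ≤ 1`. For `n = 1` this bounds the negative part of `log₂ |g'(X_1)|` by an
integrable function. For general `n`, stationarity makes the summands identically distributed, so
that the mean of the right-hand side, divided by `n`, is exactly
`(h(U) - h(V)) / n + E[log₂ |g'(X_1)|]`, infinite values included (`lintegral_add_sum_div_eq`). It
remains to let `n` tend to infinity.
-/

namespace LossRate

/-! ### Entropy of discrete conditional laws -/

/-- The entropy of a law with a countable carrier is its mean surprisal. -/
theorem entropy_eq_lintegral {α : Type*} [MeasurableSpace α] [MeasurableSingletonClass α]
    (m : Measure α) {s : Set α} (hs : s.Countable) (hm : m sᶜ = 0) :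
    entropy m = ∫⁻ x, ENNReal.ofReal (-Real.logb 2 (m.real {x})) ∂m := by
  rw [entropy, if_pos ⟨s, hs, hm⟩]
  have h0 : ∀ x ∉ s, m {x} = 0 := fun x hx =>
    measure_mono_null (singleton_subset_iff.2 hx) hm
  have hrestr : m.restrict s = m :=
    Measure.restrict_eq_self_of_ae_mem (by rwa [ae_iff])
  rw [← hrestr, lintegral_countable _ hs, hrestr]
  rw [tsum_subtype s (fun x => ENNReal.ofReal (-Real.logb 2 (m.real {x})) * m {x})]
  refine tsum_congr fun x => ?_
  by_cases hx : x ∈ s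
  · rw [indicator_of_mem hx]
    rcases eq_or_ne (m {x}) ∞ with htop | hfin
    · simp [Measure.real, htop]
    · rw [← ofReal_measureReal hfin, ← ENNReal.ofReal_mul' measureReal_nonneg]
      congr 1
      rw [Real.negMulLog, Real.logb]
      ring
  · rw [indicator_of_notMem hx]
    simp [Measure.real, h0 x hx]

theorem measurable_kernel_singleton {α β : Type*} [MeasurableSpace α] [StandardBorelSpace α]
    [MeasurableSpace β] (κ : Kernel β α) [IsMarkovKernel κ] :
    Measurable (fun z : β × α => κ z.1 {z.2}) := by
  have hdiag : MeasurableSet {w : (β × α) × α | w.2 = w.1.2} :=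
    measurableSet_eq_fun (by fun_prop) (by fun_prop)
  have h := Kernel.measurable_kernel_prodMk_left (κ := κ.prodMkRight α) hdiag
  exact h

section CondEntropy

variable {Ω α β : Type*} [MeasurableSpace Ω] [MeasurableSpace α] [StandardBorelSpace α]
  [Nonempty α] [MeasurableSpace β] (P : Measure Ω) [IsProbabilityMeasure P]

/-- A relation that holds almost surely between `V` and `U` holds, for almost every `y`, between
`y` and almost every point of the conditional law of `U` given `V = y`. -/
theorem ae_condDistrib_of_ae {U : Ω → α} {V : Ω → β} (hU : AEMeasurable U P)
    (hV : AEMeasurable V P) {R : Set (β × α)} (hR : MeasurableSet R)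
    (hUV : ∀ᵐ ω ∂P, (V ω, U ω) ∈ R) :
    ∀ᵐ y ∂(P.map V), ∀ᵐ x ∂(condDistrib U V P y), (y, x) ∈ R := by
  refine (Measure.ae_compProd_iff (p := (· ∈ R)) hR).1 ?_
  rw [compProd_map_condDistrib hU]
  exact (ae_map_iff (hV.prodMk hU) hR).2 hUV

/-- If `U` lies almost surely in a countable set determined by `V`, then `H(U | V)` is the mean of
the surprisal `-log₂ P(U = u | V = v)` at `u = U`, `v = V`. -/
theorem condEntropy_eq_lintegral {U : Ω → α} {V : Ω → β} (hU : AEMeasurable U P)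
    (hV : AEMeasurable V P) {R : Set (β × α)} (hR : MeasurableSet R)
    (hUV : ∀ᵐ ω ∂P, (V ω, U ω) ∈ R) (hcount : ∀ y, {x | (y, x) ∈ R}.Countable) :
    condEntropy P U V =
      ∫⁻ ω, ENNReal.ofReal (-Real.logb 2 ((condDistrib U V P (V ω)).real {U ω})) ∂P := by
  have hmeas : Measurable (fun z : β × α =>
      ENNReal.ofReal (-Real.logb 2 ((condDistrib U V P z.1).real {z.2}))) := by
    refine ENNReal.measurable_ofReal.comp (Measurable.neg ?_)
    exact (measurable_kernel_singleton (condDistrib U V P)).ennreal_toReal.log.div_const _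
  calc condEntropy P U V
      = ∫⁻ y, ∫⁻ x, ENNReal.ofReal (-Real.logb 2 ((condDistrib U V P y).real {x}))
          ∂(condDistrib U V P y) ∂(P.map V) := by
        refine lintegral_congr_ae ?_
        filter_upwards [ae_condDistrib_of_ae P hU hV hR hUV] with y hy
        exact entropy_eq_lintegral _ (hcount y) hy
    _ = ∫⁻ z, ENNReal.ofReal (-Real.logb 2 ((condDistrib U V P z.1).real {z.2}))
          ∂(P.map fun ω => (V ω, U ω)) := by
        rw [← compProd_map_condDistrib hU, Measure.lintegral_compProd hmeas]
    _ = _ := lintegral_map' hmeas.aemeasurable (hV.prodMk hU)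

end CondEntropy

/-! ### Point probabilities of the conditional law under a piecewise injective map -/

/-- Change of variables for a piecewise injective, piecewise differentiable map `T` and `V = T U`:
the density of `U` at `x` is the density of `V` at `T x`, times the Jacobian, times the share
`P(U = x | V = T x)` of the preimage `x` of `T x`. -/
theorem rnDeriv_eq_singleton_mul {Ω : Type*} [MeasurableSpace Ω] (P : Measure Ω)
    [IsProbabilityMeasure P] {n : ℕ} {ι : Type*} [Countable ι]
    {U V : Ω → Fin n → ℝ} (hU : AEMeasurable U P)
    (hUac : P.map U ≪ volume) (hVac : P.map V ≪ volume)
    {T : (Fin n → ℝ) → Fin n → ℝ} (hT : Measurable T) (hVT : V =ᵐ[P] fun ω => T (U ω))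
    {B : ι → Set (Fin n → ℝ)} (hB : ∀ k, MeasurableSet (B k)) (hinj : ∀ k, InjOn T (B k))
    {T' : (Fin n → ℝ) → (Fin n → ℝ) →L[ℝ] (Fin n → ℝ)}
    (hT' : ∀ k, ∀ x ∈ B k, HasFDerivWithinAt T (T' x) (B k) x)
    (hUB : ∀ᵐ ω ∂P, U ω ∈ ⋃ k, B k) :
    ∀ᵐ x ∂(P.map U), (P.map U).rnDeriv volume x =
      ENNReal.ofReal |(T' x).det| *
        ((P.map V).rnDeriv volume (T x) * condDistrib U V P (T x) {x}) := by
  set κ := condDistrib U V P with hκ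
  set q := (P.map V).rnDeriv volume with hq
  have hqm : Measurable q := Measure.measurable_rnDeriv _ _
  have hV : AEMeasurable V P := (hT.comp_aemeasurable hU).congr hVT.symm
  have : IsProbabilityMeasure (P.map V) := Measure.isProbabilityMeasure_map hV
  have : IsProbabilityMeasure (P.map U) := Measure.isProbabilityMeasure_map hU
  have hgraph : ∀ᵐ y ∂(P.map V), ∀ᵐ x ∂(κ y), T x = y := by
    refine ae_condDistrib_of_ae P hU hV (R := {z | T z.2 = z.1})
      (measurableSet_eq_fun (by fun_prop) (by fun_prop)) ?_
    filter_upwards [hVT] with ω h using h.symm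
  have hpm : Measurable (fun x => q (T x) * κ (T x) {x}) :=
    (hqm.comp hT).mul ((measurable_kernel_singleton κ).comp (hT.prodMk measurable_id))
  -- The law of `U` on a piece, computed by integrating over the image of the piece under `T`.
  have key : ∀ k, ∀ A ⊆ B k, MeasurableSet A → P.map U A =
      ∫⁻ x in A, ENNReal.ofReal |(T' x).det| * (q (T x) * κ (T x) {x}) := by
    intro k A hAB hA
    have hTA : MeasurableSet (T '' A) := hA.image_of_measurable_injOn hT ((hinj k).mono hAB)
    have hinjA := (hinj k).mono hAB
    rcases A.eq_empty_or_nonempty with rfl | hne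
    · simp
    have : Nonempty (Fin n → ℝ) := ⟨0⟩
    -- The law `κ y` lives on the fibre of `T` over `y`, which meets `A` in at most one point.
    have hon : ∀ᵐ y ∂(P.map V), y ∈ T '' A → κ y A = κ y {Function.invFunOn T A y} := by
      filter_upwards [hgraph] with y hy hyA
      refine measure_congr ?_
      filter_upwards [hy] with x hx
      refine propext ⟨fun hxA => ?_, fun hxA => ?_⟩
      · rw [← hx]
        exact (hinjA.leftInvOn_invFunOn hxA).symm
      · rw [show x = _ from hxA]
        exact Function.invFunOn_mem hyA
    have hoff : ∀ᵐ y ∂(P.map V), y ∈ (T '' A)ᶜ → κ y A = 0 := by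
      filter_upwards [hgraph] with y hy hyA
      refine measure_mono_null (fun x hx => ?_) hy
      exact fun h => hyA ⟨x, hx, h⟩
    calc P.map U A = ∫⁻ y, κ y A ∂(P.map V) := by
          rw [← condDistrib_comp_map hV hU, Measure.bind_apply hA (Kernel.aemeasurable _)]
      _ = ∫⁻ y in T '' A, κ y A ∂(P.map V) := by
          rw [← lintegral_add_compl _ hTA, setLIntegral_congr_fun_ae hTA.compl hoff]
          simp
      _ = ∫⁻ y in T '' A, q y * κ y A := by
          conv_lhs => rw [← Measure.withDensity_rnDeriv_eq _ _ hVac]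
          exact setLIntegral_withDensity_eq_setLIntegral_mul _ hqm (κ.measurable_coe hA) hTA
      _ = ∫⁻ y in T '' A, q y * κ y {Function.invFunOn T A y} := by
          -- The exceptional set is null for the law of `V`, so `q` vanishes a.e. on it.
          refine setLIntegral_congr_fun_ae hTA ?_
          rw [← Measure.withDensity_rnDeriv_eq _ _ hVac, ae_withDensity_iff hqm] at hon
          filter_upwards [hon] with y hy hyA
          by_cases h0 : q y = 0
          · simp [h0]
          · rw [hy h0 hyA]
      _ = ∫⁻ x in A, ENNReal.ofReal |(T' x).det| *
            (q (T x) * κ (T x) {Function.invFunOn T A (T x)}) :=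
          lintegral_image_eq_lintegral_abs_det_fderiv_mul volume hA
            (fun x hx => (hT' k x (hAB hx)).mono hAB) hinjA _
      _ = _ := by
          refine setLIntegral_congr_fun hA fun x hx => ?_
          simp only [hinjA.leftInvOn_invFunOn hx]
  have hpiece : ∀ k, ∀ᵐ x ∂volume, x ∈ B k → (P.map U).rnDeriv volume x =
      ENNReal.ofReal |(T' x).det| * (q (T x) * κ (T x) {x}) := by
    intro k
    rw [← ae_restrict_iff' (hB k)]
    have hfin : ∫⁻ x in B k, (P.map U).rnDeriv volume x ≠ ∞ := by
      rw [Measure.setLIntegral_rnDeriv hUac]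
      exact measure_ne_top _ _
    refine AEMeasurable.ae_eq_of_forall_setLIntegral_eq
      (Measure.measurable_rnDeriv _ _).aemeasurable
      ((aemeasurable_ofReal_abs_det_fderivWithin volume (hB k) (hT' k)).mul hpm.aemeasurable)
      hfin ?_ ?_
    · rw [← key k _ subset_rfl (hB k)]
      exact measure_ne_top _ _
    · intro s hs _
      rw [Measure.restrict_restrict hs, Measure.setLIntegral_rnDeriv hUac,
        key k _ inter_subset_right (hs.inter (hB k))]
  have hall := hUac.ae_le (ae_all_iff.2 hpiece)
  have hUB' : ∀ᵐ x ∂(P.map U), x ∈ ⋃ k, B k :=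
    (ae_map_iff hU (MeasurableSet.iUnion hB)).2 hUB
  filter_upwards [hall, hUB'] with x hx hxB
  obtain ⟨k, hk⟩ := mem_iUnion.1 hxB
  exact hx k hk

/-- The logarithmic form of `rnDeriv_eq_singleton_mul`; almost surely the density of `U` at `U` is
positive and finite, so that none of the logarithms is at a junk value. -/
theorem neg_logb_singleton_eq {Ω : Type*} [MeasurableSpace Ω] (P : Measure Ω)
    [IsProbabilityMeasure P] {n : ℕ} {ι : Type*} [Countable ι]
    {U V : Ω → Fin n → ℝ} (hU : AEMeasurable U P)
    (hUac : P.map U ≪ volume) (hVac : P.map V ≪ volume)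
    {T : (Fin n → ℝ) → Fin n → ℝ} (hT : Measurable T) (hVT : V =ᵐ[P] fun ω => T (U ω))
    {B : ι → Set (Fin n → ℝ)} (hB : ∀ k, MeasurableSet (B k)) (hinj : ∀ k, InjOn T (B k))
    {T' : (Fin n → ℝ) → (Fin n → ℝ) →L[ℝ] (Fin n → ℝ)}
    (hT' : ∀ k, ∀ x ∈ B k, HasFDerivWithinAt T (T' x) (B k) x)
    (hUB : ∀ᵐ ω ∂P, U ω ∈ ⋃ k, B k) :
    ∀ᵐ ω ∂P, -Real.logb 2 ((condDistrib U V P (V ω)).real {U ω}) =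
      Real.logb 2 (density (P.map V) (V ω)) - Real.logb 2 (density (P.map U) (U ω)) +
        Real.logb 2 |(T' (U ω)).det| := by
  have : IsProbabilityMeasure (P.map U) := Measure.isProbabilityMeasure_map hU
  have hid := ae_of_ae_map hU
    (rnDeriv_eq_singleton_mul P hU hUac hVac hT hVT hB hinj hT' hUB)
  have hpos := ae_of_ae_map hU (Measure.rnDeriv_pos hUac)
  have hlt := ae_of_ae_map hU (hUac.ae_le (Measure.rnDeriv_lt_top (P.map U) volume))
  filter_upwards [hVT, hid, hpos, hlt] with ω hω h h0 h1
  have hreal := congrArg ENNReal.toReal h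
  rw [ENNReal.toReal_mul, ENNReal.toReal_mul, ENNReal.toReal_ofReal (abs_nonneg _)] at hreal
  have hne : ((P.map U).rnDeriv volume (U ω)).toReal ≠ 0 := (ENNReal.toReal_pos h0.ne' h1.ne).ne'
  have hne' := hne
  rw [hreal] at hne'
  obtain ⟨hJ, hqp⟩ := mul_ne_zero_iff.1 hne'
  obtain ⟨hq, hp⟩ := mul_ne_zero_iff.1 hqp
  rw [hω, density, density, hreal, Real.logb_mul hJ hqp, Real.logb_mul hq hp, Measure.real]
  ring

theorem HasFiniteDiffEntropy.integrable_logb_density {n : ℕ} {μ : Measure (Fin n → ℝ)}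
    [IsProbabilityMeasure μ] (h : HasFiniteDiffEntropy μ) :
    Integrable (fun x => Real.logb 2 (density μ x)) μ := by
  have h1 : Integrable (fun x => Real.log (density μ x)) μ := by
    rw [← integrable_rnDeriv_smul_iff h.1]
    refine h.2.neg.congr (Eventually.of_forall fun x => ?_)
    simp [Real.negMulLog, density]
  exact h1.div_const _

theorem HasFiniteDiffEntropy.integral_logb_density {n : ℕ} {μ : Measure (Fin n → ℝ)}
    [IsProbabilityMeasure μ] (h : HasFiniteDiffEntropy μ) :
    ∫ x, Real.logb 2 (density μ x) ∂μ = -diffEntropy μ := by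
  rw [← integral_rnDeriv_smul h.1, diffEntropy, ← integral_neg]
  refine integral_congr_ae (Eventually.of_forall fun x => ?_)
  simp only [Real.negMulLog, density, Real.logb, smul_eq_mul]
  ring

/-! ### Extended expectations -/

section ExtExpectation

variable {Ω : Type*} [MeasurableSpace Ω] {P : Measure Ω}

theorem integrable_of_lintegral_ofReal {Z : Ω → ℝ} (hZ : AEMeasurable Z P)
    (hpos : ∫⁻ ω, ENNReal.ofReal (Z ω) ∂P ≠ ∞) (hneg : ∫⁻ ω, ENNReal.ofReal (-Z ω) ∂P ≠ ∞) :
    Integrable Z P := by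
  refine ⟨hZ.aestronglyMeasurable, (hasFiniteIntegral_iff_norm _).2 ?_⟩
  calc ∫⁻ ω, ENNReal.ofReal ‖Z ω‖ ∂P
      ≤ ∫⁻ ω, (ENNReal.ofReal (Z ω) + ENNReal.ofReal (-Z ω)) ∂P := by
        refine lintegral_mono fun ω => ?_
        rcases abs_choice (Z ω) with h | h <;> rw [Real.norm_eq_abs, h]
        · exact le_self_add
        · exact le_add_self
    _ = ∫⁻ ω, ENNReal.ofReal (Z ω) ∂P + ∫⁻ ω, ENNReal.ofReal (-Z ω) ∂P :=
        lintegral_add_left' hZ.ennreal_ofReal _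
    _ < ∞ := ENNReal.add_lt_top.2 ⟨hpos.lt_top, hneg.lt_top⟩

theorem extExpectation_eq_integral {Z : Ω → ℝ} (hZ : Integrable Z P) :
    extExpectation P Z = ((∫ ω, Z ω ∂P : ℝ) : EReal) := by
  have hp : ∫⁻ ω, ENNReal.ofReal (Z ω) ∂P ≠ ∞ := hZ.lintegral_lt_top.ne
  have hn : ∫⁻ ω, ENNReal.ofReal (-Z ω) ∂P ≠ ∞ := hZ.neg.lintegral_lt_top.ne
  rw [integral_eq_lintegral_pos_part_sub_lintegral_neg_part hZ, EReal.coe_sub,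
    EReal.coe_ennreal_toReal hp, EReal.coe_ennreal_toReal hn, extExpectation]

/-- If `a + Z₀ + ⋯ + Zₙ₋₁ ≥ 0`, where the `Zᵢ` are identically distributed with finite
`E[Zᵢ⁻]` and `a` is integrable, then the mean of the sum, divided by `n`, is `E[a] / n + E[Z₀]`,
both sides being infinite together. -/
theorem lintegral_add_sum_div_eq {n : ℕ} (hn : n ≠ 0) {a : Ω → ℝ}
    (ha : Integrable a P) {Z : ℕ → Ω → ℝ} (hZ : ∀ i, IdentDistrib (Z i) (Z 0) P P)
    (hneg : ∫⁻ ω, ENNReal.ofReal (-Z 0 ω) ∂P ≠ ∞)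
    (hnonneg : ∀ᵐ ω ∂P, 0 ≤ a ω + ∑ i ∈ Finset.range n, Z i ω) :
    (((∫⁻ ω, ENNReal.ofReal (a ω + ∑ i ∈ Finset.range n, Z i ω) ∂P) / (n : ℝ≥0∞) : ℝ≥0∞) : EReal)
      = (((∫ ω, a ω ∂P) / n : ℝ) : EReal) + extExpectation P (Z 0) := by
  have hn0 : (0 : ℝ) < n := by positivity
  by_cases hpos : ∫⁻ ω, ENNReal.ofReal (Z 0 ω) ∂P = ∞
  · -- Were the mean of the sum finite, `Z₀⁺` would be dominated by an integrable function:
    -- `Z₀ ≤ (a + ∑ Zᵢ) - a + ∑ Zᵢ⁻`.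
    have htop : ∫⁻ ω, ENNReal.ofReal (a ω + ∑ i ∈ Finset.range n, Z i ω) ∂P = ∞ := by
      by_contra hfin
      have hnegi : ∀ i, ∫⁻ ω, ENNReal.ofReal (-Z i ω) ∂P ≠ ∞ := by
        intro i
        have := ((hZ i).comp (u := fun z => ENNReal.ofReal (-z)) (by fun_prop)).lintegral_eq
        simp only [Function.comp_def] at this
        rwa [this]
      have hle : ∫⁻ ω, ENNReal.ofReal (Z 0 ω) ∂P ≤
          ∫⁻ ω, (ENNReal.ofReal (a ω + ∑ i ∈ Finset.range n, Z i ω) + ENNReal.ofReal (-a ω) +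
            ∑ i ∈ Finset.range n, ENNReal.ofReal (-Z i ω)) ∂P := by
        refine lintegral_mono fun ω => ?_
        have h1 : Z 0 ω ≤ (a ω + ∑ i ∈ Finset.range n, Z i ω) + -a ω +
            ∑ i ∈ Finset.range n, max (-Z i ω) 0 := by
          have h0 : (0 : ℕ) ∈ Finset.range n := Finset.mem_range.2 (Nat.pos_of_ne_zero hn)
          have h2 : Z 0 ω ≤ ∑ i ∈ Finset.range n, (Z i ω + max (-Z i ω) 0) := by
            refine le_trans (by linarith [le_max_right (-Z 0 ω) 0])
              (Finset.single_le_sum (f := fun i => Z i ω + max (-Z i ω) 0) (fun i _ => ?_) h0)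
            linarith [le_max_left (-Z i ω) 0]
          rw [Finset.sum_add_distrib] at h2
          linarith
        refine (ENNReal.ofReal_le_ofReal h1).trans ?_
        refine ENNReal.ofReal_add_le.trans (add_le_add ENNReal.ofReal_add_le ?_)
        rw [ENNReal.ofReal_sum_of_nonneg (fun i _ => le_max_right _ _)]
        simp
      rw [hpos, top_le_iff] at hle
      refine absurd hle ?_
      have hm : ∀ i, AEMeasurable (Z i) P := fun i => (hZ i).aemeasurable_fst
      have ham := ha.aemeasurable
      rw [lintegral_add_right' _ (by fun_prop), lintegral_add_right' _ (by fun_prop),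
        lintegral_finsetSum' _ (fun i _ => by fun_prop)]
      simp only [ENNReal.add_ne_top, ENNReal.sum_ne_top]
      exact ⟨⟨hfin, ha.neg.lintegral_lt_top.ne⟩, fun i _ => hnegi i⟩
    rw [htop, ENNReal.top_div_of_ne_top (ENNReal.natCast_ne_top n), extExpectation, hpos]
    rw [← EReal.coe_ennreal_toReal hneg, EReal.coe_ennreal_top, EReal.top_sub_coe,
      EReal.coe_add_top]
  · have hZ0 : Integrable (Z 0) P :=
      integrable_of_lintegral_ofReal (hZ 0).aemeasurable_fst hpos hneg
    have hZi : ∀ i, Integrable (Z i) P := fun i => (hZ i).integrable_iff.2 hZ0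
    have hsum : Integrable (fun ω => ∑ i ∈ Finset.range n, Z i ω) P :=
      integrable_finsetSum _ fun i _ => hZi i
    have hint : ∫ ω, (a ω + ∑ i ∈ Finset.range n, Z i ω) ∂P =
        ∫ ω, a ω ∂P + n * ∫ ω, Z 0 ω ∂P := by
      rw [integral_add ha hsum, integral_finsetSum _ fun i _ => hZi i,
        Finset.sum_congr rfl fun i _ => (hZ i).integral_eq]
      simp
    have hC : ∫⁻ ω, ENNReal.ofReal (a ω + ∑ i ∈ Finset.range n, Z i ω) ∂P =
        ENNReal.ofReal (∫ ω, a ω ∂P + n * ∫ ω, Z 0 ω ∂P) := by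
      rw [← hint]
      exact (ofReal_integral_eq_lintegral_ofReal (ha.add hsum) hnonneg).symm
    have h0 : 0 ≤ ∫ ω, a ω ∂P + n * ∫ ω, Z 0 ω ∂P := hint ▸ integral_nonneg_of_ae hnonneg
    rw [hC, ← ENNReal.ofReal_natCast, ← ENNReal.ofReal_div_of_pos hn0, EReal.coe_ennreal_ofReal,
      extExpectation_eq_integral hZ0, max_eq_left (div_nonneg h0 hn0.le), ← EReal.coe_add]
    congr 1
    field_simp

end ExtExpectation

/-! ### Piecewise bijective functions -/

section PiecewiseBijective

variable {ι : Type*} [Countable ι] {μ : Measure ℝ} {D E : Set ℝ} {S : ι → Set ℝ} {g : ℝ → ℝ}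

theorem IsPBF.measurableSet (hg : IsPBF μ D E S g) : MeasurableSet D :=
  hg.iUnion_eq ▸ MeasurableSet.iUnion hg.measurableSet_piece

theorem IsPBF.subset (hg : IsPBF μ D E S g) (i : ι) : S i ⊆ D :=
  hg.iUnion_eq ▸ subset_iUnion S i

/-- Nothing is known of `g` outside `D`; extending `g` from `D` by `0` gives a Borel function. -/
theorem IsPBF.measurable_indicator (hg : IsPBF μ D E S g) : Measurable (D.indicator g) := by
  refine measurable_of_restrict_of_restrict_compl hg.measurableSet ?_ ?_
  · rw [show D.domRestrict (D.indicator g) = fun x : D => g x from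
      funext fun x => indicator_of_mem x.2 g]
    exact hg.measurable
  · rw [show Dᶜ.domRestrict (D.indicator g) = fun _ => 0 from
      funext fun x => indicator_of_notMem x.2 g]
    exact measurable_const

theorem IsPBF.hasDerivWithinAt (hg : IsPBF μ D E S g) {i : ι} {x : ℝ} (hx : x ∈ S i) :
    HasDerivWithinAt (D.indicator g) (pieceDeriv S g x) (S i) x := by
  have hS : (⋃ j, ⋃ (_ : x ∈ S j), S j) = S i := by
    refine subset_antisymm (iUnion₂_subset fun j hj => ?_)
      (subset_iUnion₂_of_subset i hx subset_rfl)
    rcases eq_or_ne j i with rfl | hji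
    · exact subset_rfl
    · exact ((hg.disjoint hji).le_bot ⟨hj, hx⟩).elim
  rw [pieceDeriv, hS]
  refine (hg.differentiable i x hx).hasDerivWithinAt.congr (fun y hy => ?_) ?_
  · exact indicator_of_mem (hg.subset i hy) g
  · exact indicator_of_mem (hg.subset i hx) g

theorem IsPBF.injOn_indicator (hg : IsPBF μ D E S g) (i : ι) : InjOn (D.indicator g) (S i) :=
  (hg.bijOn i).injOn.congr fun _ hx => (indicator_of_mem (hg.subset i hx) g).symm

theorem IsPBF.aemeasurable_pieceDeriv (hg : IsPBF μ D E S g) :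
    AEMeasurable (pieceDeriv S g) (volume.restrict D) := by
  rw [← hg.iUnion_eq, aemeasurable_iUnion_iff]
  intro i
  have h := aemeasurable_fderivWithin volume (hg.measurableSet_piece i)
    fun x hx => (hg.hasDerivWithinAt hx).hasFDerivWithinAt
  simpa using h.apply_continuousLinearMap 1

/-- The coordinatewise application of `g` is differentiable on each box
`S (k 0) × ⋯ × S (k (n - 1))`, with a diagonal derivative. -/
theorem IsPBF.hasFDerivWithinAt_box (hg : IsPBF μ D E S g) {n : ℕ} (k : Fin n → ι)
    {x : Fin n → ℝ} (hx : x ∈ univ.pi fun i => S (k i)) :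
    HasFDerivWithinAt (fun (z : Fin n → ℝ) i => D.indicator g (z i))
      (ContinuousLinearMap.pi fun i =>
        (ContinuousLinearMap.toSpanSingleton ℝ (pieceDeriv S g (x i))).comp
          (ContinuousLinearMap.proj i))
      (univ.pi fun i => S (k i)) x := by
  refine hasFDerivWithinAt_pi.2 fun i => ?_
  have hmaps : MapsTo (fun z : Fin n → ℝ => z i) (univ.pi fun i => S (k i)) (S (k i)) :=
    fun z hz => hz i trivial
  exact (hg.hasDerivWithinAt (hx i trivial)).hasFDerivWithinAt.comp x
    (ContinuousLinearMap.proj (R := ℝ) (φ := fun _ : Fin n => ℝ) i).hasFDerivWithinAt hmaps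

end PiecewiseBijective

/-! ### Blocks of a process -/

theorem measurable_block {Ω : Type*} [MeasurableSpace Ω] {X : ℕ → Ω → ℝ}
    (hX : ∀ n, Measurable (X n)) (n : ℕ) : Measurable (block X n) :=
  measurable_pi_lambda _ fun i => hX i

theorem map_absolutelyContinuous_of_block_one {Ω : Type*} [MeasurableSpace Ω] {P : Measure Ω}
    {X : ℕ → Ω → ℝ} (hX : ∀ n, Measurable (X n)) (h : P.map (block X 1) ≪ volume) :
    P.map (X 0) ≪ volume := by
  have h1 : P.map (X 0) = (P.map (block X 1)).map (Function.eval 0) := by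
    rw [Measure.map_map (measurable_pi_apply _) (measurable_block hX 1)]
    rfl
  rw [h1]
  exact (h.map (measurable_pi_apply _)).trans
    (Measure.quasiMeasurePreserving_eval
      (fun _ : Fin 1 => (volume : Measure ℝ)) 0).absolutelyContinuous

theorem IsStationary.identDistrib {Ω : Type*} [MeasurableSpace Ω] {P : Measure Ω}
    {X : ℕ → Ω → ℝ} (hX : IsStationary P X) (k : ℕ) : IdentDistrib (X k) (X 0) P P := by
  have h := (hX k).comp (measurable_pi_apply 0)
  simpa [Function.comp_def] using h

/-- The surprisal of `X_1^n` given `Y_1^n` is almost surely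
`log₂ q(Y_1^n) - log₂ f(X_1^n) + ∑ log₂ |g'(X_i)|`, with `f` and `q` the densities of the two
blocks; its mean is `H(X_1^n | Y_1^n)`. -/
theorem condEntropy_block {Ω : Type*} [MeasurableSpace Ω] (P : Measure Ω) [IsProbabilityMeasure P]
    {X Y : ℕ → Ω → ℝ} (hX : ∀ n, Measurable (X n))
    {ι : Type*} [Countable ι] {μ : Measure ℝ} {D E : Set ℝ} {S : ι → Set ℝ} {g : ℝ → ℝ}
    (hXD : ∀ n, ∀ᵐ ω ∂P, X n ω ∈ D) (hg : IsPBF μ D E S g)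
    (hd : ∀ i, ∀ᵐ ω ∂P, pieceDeriv S g (X i ω) ≠ 0)
    (hY : ∀ n ω, Y n ω = g (X n ω)) {n : ℕ}
    (hXac : P.map (block X n) ≪ volume) (hYac : P.map (block Y n) ≪ volume) :
    AEMeasurable (block Y n) P ∧
    (∀ᵐ ω ∂P, 0 ≤ Real.logb 2 (density (P.map (block Y n)) (block Y n ω)) -
        Real.logb 2 (density (P.map (block X n)) (block X n ω)) +
        ∑ i ∈ Finset.range n, Real.logb 2 |pieceDeriv S g (X i ω)|) ∧
    condEntropy P (block X n) (block Y n) =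
      ∫⁻ ω, ENNReal.ofReal (Real.logb 2 (density (P.map (block Y n)) (block Y n ω)) -
        Real.logb 2 (density (P.map (block X n)) (block X n ω)) +
        ∑ i ∈ Finset.range n, Real.logb 2 |pieceDeriv S g (X i ω)|) ∂P := by
  set T : (Fin n → ℝ) → Fin n → ℝ := fun z i => D.indicator g (z i) with hTdef
  set B : (Fin n → ι) → Set (Fin n → ℝ) := fun k => univ.pi fun i => S (k i) with hBdef
  have hT : Measurable T :=
    measurable_pi_lambda _ fun i => hg.measurable_indicator.comp (measurable_pi_apply i)
  have hU := measurable_block hX n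
  have hXD' : ∀ᵐ ω ∂P, ∀ n, X n ω ∈ D := ae_all_iff.2 hXD
  have hVT : block Y n =ᵐ[P] fun ω => T (block X n ω) := by
    filter_upwards [hXD'] with ω hω
    funext i
    simp only [block, hTdef, hY, indicator_of_mem (hω i)]
  have hV : AEMeasurable (block Y n) P := (hT.comp hU).aemeasurable.congr hVT.symm
  have hB : ∀ k, MeasurableSet (B k) := fun k =>
    MeasurableSet.univ_pi fun i => hg.measurableSet_piece (k i)
  have hinj : ∀ k, InjOn T (B k) := fun k x hx y hy hxy => funext fun i =>
    hg.injOn_indicator (k i) (hx i trivial) (hy i trivial) (congrFun hxy i)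
  have hUB : ∀ᵐ ω ∂P, block X n ω ∈ ⋃ k, B k := by
    filter_upwards [hXD'] with ω hω
    have : ∀ i : Fin n, ∃ j, X i ω ∈ S j := fun i => by
      have := hω i
      rwa [← hg.iUnion_eq, mem_iUnion] at this
    choose k hk using this
    exact mem_iUnion.2 ⟨k, fun i _ => hk i⟩
  have hid := neg_logb_singleton_eq P hU.aemeasurable hXac hYac hT hVT hB hinj
    (fun k x hx => hg.hasFDerivWithinAt_box k hx) hUB
  have hsurp : ∀ᵐ ω ∂P, -Real.logb 2 ((condDistrib (block X n) (block Y n) P (block Y n ω)).real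
        {block X n ω}) = Real.logb 2 (density (P.map (block Y n)) (block Y n ω)) -
        Real.logb 2 (density (P.map (block X n)) (block X n ω)) +
        ∑ i ∈ Finset.range n, Real.logb 2 |pieceDeriv S g (X i ω)| := by
    filter_upwards [hid, ae_all_iff.2 hd] with ω hω hω0
    rw [hω, ContinuousLinearMap.det_pi, Finset.abs_prod,
      Real.logb_prod _ _ (fun i _ => ?_), Finset.sum_range]
    · simp [block]
    · simpa [block] using hω0 i
  refine ⟨hV, ?_, ?_⟩
  · filter_upwards [hsurp] with ω hω
    rw [← hω]
    exact neg_nonneg.2 (Real.logb_nonpos one_lt_two measureReal_nonneg measureReal_le_one)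
  · rw [condEntropy_eq_lintegral P hU.aemeasurable hV
      (R := {z | z.2 ∈ ⋃ k, B k} ∩ {z | T z.2 = z.1})]
    · refine lintegral_congr_ae ?_
      filter_upwards [hsurp] with ω hω
      rw [hω]
    · exact (measurable_snd (MeasurableSet.iUnion hB)).inter
        (measurableSet_eq_fun (by fun_prop) (by fun_prop))
    · filter_upwards [hUB, hVT] with ω h1 h2 using ⟨h1, h2.symm⟩
    · intro y
      have hsub : {x | (y, x) ∈ {z : (Fin n → ℝ) × (Fin n → ℝ) | z.2 ∈ ⋃ k, B k} ∩
          {z | T z.2 = z.1}} ⊆ ⋃ k, {x | x ∈ B k ∧ T x = y} := by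
        rintro x ⟨hx, hxy⟩
        obtain ⟨k, hk⟩ := mem_iUnion.1 hx
        exact mem_iUnion.2 ⟨k, hk, hxy⟩
      refine (countable_iUnion fun k => Set.Subsingleton.countable ?_).mono hsub
      rintro a ⟨ha, ha'⟩ b ⟨hb, hb'⟩
      exact hinj k ha hb (ha'.trans hb'.symm)

end LossRate

theorem proposition1 {Ω : Type*} [MeasurableSpace Ω] (P : Measure Ω) [IsProbabilityMeasure P]
    (X : ℕ → Ω → ℝ) (hXmeas : ∀ n, Measurable (X n)) (hXstat : LossRate.IsStationary P X)
    {ι : Type*} [Countable ι] (D E : Set ℝ) (S : ι → Set ℝ) (g : ℝ → ℝ)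
    (hXD : ∀ n, ∀ᵐ ω ∂P, X n ω ∈ D)
    (hg : LossRate.IsPBF (P.map (X 0)) D E S g)
    (Y : ℕ → Ω → ℝ) (hY : ∀ n ω, Y n ω = g (X n ω))
    (hXfin : ∀ n, LossRate.HasFiniteDiffEntropy (P.map (LossRate.block X n)))
    (hYfin : ∀ n, LossRate.HasFiniteDiffEntropy (P.map (LossRate.block Y n)))
    (rX rY : ℝ) (hrX : LossRate.HasDiffEntropyRate P X rX)
    (hrY : LossRate.HasDiffEntropyRate P Y rY) :
    AEMeasurable (fun ω => Real.logb 2 |LossRate.pieceDeriv S g (X 0 ω)|) P ∧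
    (∫⁻ ω, ENNReal.ofReal (-Real.logb 2 |LossRate.pieceDeriv S g (X 0 ω)|) ∂P) ≠ ∞ ∧
    Tendsto
      (fun n : ℕ =>
        ((LossRate.condEntropy P (LossRate.block X n) (LossRate.block Y n) / (n : ℝ≥0∞) : ℝ≥0∞) :
          EReal))
      atTop
      (𝓝 (((rX - rY : ℝ) : EReal) +
        LossRate.extExpectation P
          (fun ω => Real.logb 2 |LossRate.pieceDeriv S g (X 0 ω)|))) := by
  set Z : ℕ → Ω → ℝ := fun i ω => Real.logb 2 |LossRate.pieceDeriv S g (X i ω)| with hZdef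
  have hXlaw : P.map (X 0) ≪ volume :=
    LossRate.map_absolutelyContinuous_of_block_one hXmeas (hXfin 1).1
  have hlawD : (P.map (X 0)).restrict D = P.map (X 0) :=
    Measure.restrict_eq_self_of_ae_mem
      ((ae_map_iff (hXmeas 0).aemeasurable hg.measurableSet).2 (hXD 0))
  have hlogm : AEMeasurable (fun x => Real.logb 2 |LossRate.pieceDeriv S g x|) (P.map (X 0)) := by
    have hd : AEMeasurable (LossRate.pieceDeriv S g) (P.map (X 0)) :=
      hg.aemeasurable_pieceDeriv.mono_ac (hlawD ▸ hXlaw.restrict D)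
    exact hd.abs.log.div_const _
  have hZid : ∀ i, IdentDistrib (Z i) (Z 0) P P := fun i =>
    ((hXstat.identDistrib i).symm.comp_of_aemeasurable hlogm).symm
  have hZm : AEMeasurable (Z 0) P := (hZid 0).aemeasurable_fst
  set a : ℕ → Ω → ℝ := fun n ω =>
    Real.logb 2 (LossRate.density (P.map (LossRate.block Y n)) (LossRate.block Y n ω)) -
      Real.logb 2 (LossRate.density (P.map (LossRate.block X n)) (LossRate.block X n ω)) with hadef
  have hd0 : ∀ i, ∀ᵐ ω ∂P, LossRate.pieceDeriv S g (X i ω) ≠ 0 := fun i =>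
    ae_of_ae_map (hXmeas i).aemeasurable
      ((hXstat.identDistrib i).map_eq ▸ hg.deriv_ne_zero)
  have hH := fun n => LossRate.condEntropy_block P hXmeas hXD hg hd0 hY (hXfin n).1 (hYfin n).1
  have ha : ∀ n, Integrable (a n) P ∧ ∫ ω, a n ω ∂P =
      LossRate.diffEntropy (P.map (LossRate.block X n)) -
        LossRate.diffEntropy (P.map (LossRate.block Y n)) := by
    intro n
    have hU := (LossRate.measurable_block hXmeas n).aemeasurable (μ := P)
    have hV := (hH n).1
    have := Measure.isProbabilityMeasure_map hU
    have := Measure.isProbabilityMeasure_map hV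
    have hiX := (hXfin n).integrable_logb_density
    have hiY := (hYfin n).integrable_logb_density
    have hiX' := hiX.comp_aemeasurable hU
    have hiY' := hiY.comp_aemeasurable hV
    refine ⟨hiY'.sub hiX', ?_⟩
    have h1 := integral_map hU hiX.aestronglyMeasurable
    have h2 := integral_map hV hiY.aestronglyMeasurable
    rw [(hXfin n).integral_logb_density] at h1
    rw [(hYfin n).integral_logb_density] at h2
    calc ∫ ω, a n ω ∂P = _ - _ := integral_sub hiY' hiX'
      _ = _ := by
        rw [← h1, ← h2]
        ring
  -- The case `n = 1`: `a 1 + Z 0 ≥ 0`, so the negative part of `Z 0` is at most `(a 1)⁺`.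
  have hneg : ∫⁻ ω, ENNReal.ofReal (-Z 0 ω) ∂P ≠ ∞ := by
    refine ne_top_of_le_ne_top (ha 1).1.lintegral_lt_top.ne (lintegral_mono_ae ?_)
    filter_upwards [(hH 1).2.1] with ω hω
    refine ENNReal.ofReal_le_ofReal ?_
    rw [Finset.sum_range_one] at hω
    simp only [hadef, hZdef]
    linarith
  refine ⟨hZm, hneg, ?_⟩
  have hlim : Tendsto (fun n : ℕ => (((∫ ω, a n ω ∂P) / n : ℝ) : EReal)) atTop
      (𝓝 ((rX - rY : ℝ) : EReal)) := by
    refine (continuous_coe_real_ereal.tendsto _).comp ((hrX.sub hrY).congr fun n => ?_)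
    rw [(ha n).2, sub_div]
  have hadd : Tendsto (fun n : ℕ => (((∫ ω, a n ω ∂P) / n : ℝ) : EReal) +
      LossRate.extExpectation P (Z 0)) atTop
      (𝓝 (((rX - rY : ℝ) : EReal) + LossRate.extExpectation P (Z 0))) :=
    (EReal.continuousAt_add (p := (((rX - rY : ℝ) : EReal), LossRate.extExpectation P (Z 0)))
      (Or.inl (EReal.coe_ne_top _)) (Or.inl (EReal.coe_ne_bot _))).tendsto.comp
      (hlim.prodMk_nhds tendsto_const_nhds)
  -- For `n ≠ 0` the sequence is equal, not just asymptotic, to the one in `hadd`.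
  refine hadd.congr' ?_
  filter_upwards [eventually_ne_atTop 0] with n hn
  rw [(hH n).2.2]
  exact (LossRate.lintegral_add_sum_div_eq hn (ha n).1 hZid hneg (hH n).2.1).symm
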